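/- Let $I\subseteq\mathbb R$ be an interval with more than one point (for instance $I=\mathbb R$) and let $\alpha:I\to\mathbb R^3$ be a polynomial curve of degree $5$, i.e. the coordinates of $\alpha$ are real polynomials in the parameter $t$ and the largest of their degrees is $5$. Assume that $\alpha$ is not contained in a plane. Call $\alpha$ a helix if it has constant slope, i.e. if there are a vector $u\neq 0$ and a number $\theta$ such that the angle between $u$ and $\alpha'(t)$ equals $\theta$ for all $t\in I$ with $\alpha'(t)\ne 0$. Call $\alpha$ a $2$-PH curve (Pythagorean hodograph curve of second class) if $\|\alpha'\|$ is a polynomial function and $\|\alpha'\wedge\alpha''\|$ is, up to sign, a polynomial function, i.e. if there are real polynomials $\sigma,\rho$ such that $$\|\alpha'(t)\|=\sigma(t)\qquad\text{and}\qquad \|\alpha'(t)\wedge\alpha''(t)\|=|\rho(t)|\qquad\text{for all } t\in I$$ (the second condition says that $\|\alpha'\wedge\alpha''\|^2$ is the square of a polynomial; at points where $\alpha'\wedge\alpha''$ does not vanish the absolute value only fixes a sign). Then $\alpha$ is a helix if and only if it is a $2$-PH curve. -/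

import Mathlib

open Polynomial

/-- Euclidean three-space. -/
abbrev Space3 : Type := EuclideanSpace ℝ (Fin 3)

/-- The vector product of Euclidean three-space. -/
noncomputable def wedge (v w : Space3) : Space3 :=
  WithLp.toLp 2 (crossProduct v.ofLp w.ofLp)

/-- `α` is a polynomial space curve of degree `d`: its coordinates are real polynomials in the
parameter, and the largest of their degrees is `d`. -/
def IsPolynomialCurve (α : ℝ → Space3) (d : ℕ) : Prop :=
  ∃ P : Fin 3 → ℝ[X], (∀ t i, α t i = (P i).eval t) ∧
    (Finset.univ.sup fun i => (P i).natDegree) = d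

/-- The part of `α` over `I` lies in an affine plane. -/
def IsPlanarOn (α : ℝ → Space3) (I : Set ℝ) : Prop :=
  ∃ n : Space3, n ≠ 0 ∧ ∃ d : ℝ, ∀ t ∈ I, inner ℝ n (α t) = d

/-- `α` is a (generalized) helix over `I`: wherever the tangent vector is defined, it makes a
constant angle with a fixed direction. -/
def IsHelixOn (α : ℝ → Space3) (I : Set ℝ) : Prop :=
  ∃ u : Space3, u ≠ 0 ∧ ∃ θ : ℝ, ∀ t ∈ I, deriv α t ≠ 0 →
    InnerProductGeometry.angle u (deriv α t) = θ

/-- `α` is a Pythagorean hodograph curve of second class over `I`: `‖α'‖` is polynomial, and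
`‖α' ∧ α''‖` is polynomial up to sign, that is, its square is the square of a polynomial (the sign
of that polynomial changes where the binormal vector is reversed, at an inflection point). -/
def Is2PHOn (α : ℝ → Space3) (I : Set ℝ) : Prop :=
  (∃ σ : ℝ[X], ∀ t ∈ I, ‖deriv α t‖ = σ.eval t) ∧
    ∃ ρ : ℝ[X], ∀ t ∈ I, ‖wedge (deriv α t) (deriv (deriv α) t)‖ = |ρ.eval t|

/-!
Write `v = α' = (x, y, z)`, a triple of real polynomials of degree at most four. If `‖v‖` is a
polynomial `s`, then `α` is a helix exactly when `x, y, z, s` are linearly dependent over `ℝ`: a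
relation says that the inner product of `v` with a fixed vector is a fixed multiple of `‖v‖`.

A helix is a 2-PH curve in every degree. From `⟪u, v⟫ = m ‖v‖` one gets `‖v‖` by dividing by `m`,
and the Gram determinant of `u, v, v'` equals `(‖u‖² - m²) ‖v ∧ v'‖²`
(`det_sq_eq_mul_wedge_sq`). Both `m = 0` and `‖u‖² = m²` would make the curve planar.

For the converse, `(x + iy)(x - iy) = (s + z)(s - z)` in `ℂ[X]`, and unique factorization gives
`x + iy = k a b̄`, `s + z = k a ā`, `s - z = k b b̄` with `a, b` coprime and `k` real
(`exists_hopf_factorization`); that is, `a / b` is the stereographic projection of the unit tangent.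
Here `a` and `b` have degree at most two because `s ± z` have degree at most four. In these terms
`‖v ∧ v'‖² = s² k² w w̄`, where `w = a b' - a' b` is the Wronskian, so `w w̄` is a square in `ℂ[X]`.

The Wronskian has degree at most two. A double root of `w` would be a common root of `a` and `b`,
so `w` is zero or squarefree (`squarefree_wronskian`). In the first case `a` and `b` are constants.
In the second, `w` divides the square root of `w w̄`, whence `w̄` is a constant multiple of `w`. The
coefficients of `w` are, up to fixed factors, the Plücker coordinates of the plane spanned by `a` and
`b` in the space of quadratic polynomials, so this plane is invariant under conjugation. In both cases
`ā = A a + B b` and `b̄ = A' a + B' b` for constants (`exists_conj_eq_combination`), and expanding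
`b̄ ā = ā b̄` with these gives `A' a ā + B' ā b - A a b̄ - B b b̄ = 0`. Multiplied by `k`, this is
a linear relation between `s + z`, `x - iy`, `x + iy` and `s - z`, hence between `x, y, z, s`.
-/

/-! ### Conjugation of complex polynomials -/

/-- Coefficientwise complex conjugation of polynomials. -/
noncomputable abbrev conjPoly : ℂ[X] →+* ℂ[X] := Polynomial.mapRingHom (starRingEnd ℂ)

lemma conjPoly_conjPoly (p : ℂ[X]) : conjPoly (conjPoly p) = p := by
  ext n
  simp [conjPoly]

lemma derivative_conjPoly (p : ℂ[X]) :
    derivative (conjPoly p) = conjPoly (derivative p) := by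
  simp [conjPoly, Polynomial.derivative_map]

lemma natDegree_conjPoly (p : ℂ[X]) : (conjPoly p).natDegree = p.natDegree := by
  simp [conjPoly]

/-! ### Factorization of a spatial Pythagorean hodograph -/

/-- The Hopf form of a solution of `Z * Z̄ = P * N` with `N` real: writing `Z / N = a / b` in lowest
terms, `b̄` divides both `g * a` and `g * b` for the common factor `g` of `Z` and `N`, hence it
divides `g`. -/
lemma exists_hopf_factorization {Z P N : ℂ[X]} (h : Z * conjPoly Z = P * N)
    (hN : conjPoly N = N) (hN0 : N ≠ 0) :
    ∃ k a b : ℂ[X], IsCoprime a b ∧ b ≠ 0 ∧ conjPoly k = k ∧ Z = k * (a * conjPoly b) ∧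
      P = k * (a * conjPoly a) ∧ N = k * (b * conjPoly b) := by
  obtain ⟨g, a, b, hab, hZ, hNg⟩ :
      ∃ g a b : ℂ[X], IsCoprime a b ∧ Z = g * a ∧ N = g * b := by
    have hg : EuclideanDomain.gcd Z N ≠ 0 := fun h0 => hN0 (EuclideanDomain.gcd_eq_zero_iff.1 h0).2
    obtain ⟨a, ha⟩ := EuclideanDomain.gcd_dvd_left Z N
    obtain ⟨b, hb⟩ := EuclideanDomain.gcd_dvd_right Z N
    refine ⟨EuclideanDomain.gcd Z N, a, b, ?_, ha, hb⟩
    have hbez := EuclideanDomain.gcd_eq_gcd_ab Z N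
    refine ⟨EuclideanDomain.gcdA Z N, EuclideanDomain.gcdB Z N, mul_left_cancel₀ hg ?_⟩
    linear_combination (-1 : ℂ[X]) * hbez - EuclideanDomain.gcdA Z N * ha
      - EuclideanDomain.gcdB Z N * hb
  have hg0 : g ≠ 0 := by rintro rfl; simp at hNg; exact hN0 hNg
  have hb0 : b ≠ 0 := by rintro rfl; simp at hNg; exact hN0 hNg
  have hcb0 : conjPoly b ≠ 0 := fun h0 => hb0 (by rw [← conjPoly_conjPoly b, h0, map_zero])
  -- `a * conj Z = P * b`, so `b` divides `conj Z`.
  have h1 : a * conjPoly Z = P * b := by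
    apply mul_left_cancel₀ hg0
    linear_combination h - conjPoly Z * hZ + P * hNg
  obtain ⟨m, hm⟩ : b ∣ conjPoly Z := hab.symm.dvd_of_dvd_mul_left ⟨P, by rw [h1]; ring⟩
  have h2 : g * a = conjPoly b * conjPoly m := by
    rw [← hZ, ← map_mul, ← hm, conjPoly_conjPoly]
  have h3 : g * b = conjPoly g * conjPoly b := by rw [← hNg, ← map_mul, ← hNg, hN]
  obtain ⟨k, hk⟩ : conjPoly b ∣ g := by
    obtain ⟨s, t, hst⟩ := hab
    refine ⟨s * conjPoly m + t * conjPoly g, ?_⟩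
    linear_combination (-g) * hst + s * h2 + t * h3
  have hN' : N = k * (b * conjPoly b) := by rw [hNg, hk]; ring
  have hkk : conjPoly k = k := by
    have h4 := hN
    rw [hN', map_mul, map_mul, conjPoly_conjPoly] at h4
    apply mul_right_cancel₀ (mul_ne_zero hb0 hcb0)
    linear_combination h4
  refine ⟨k, a, b, hab, hb0, hkk, by rw [hZ, hk]; ring, ?_, hN'⟩
  have h5 : conjPoly Z = k * (conjPoly a * b) := by
    rw [hZ, hk, map_mul, map_mul, conjPoly_conjPoly, hkk]; ring
  apply mul_right_cancel₀ hb0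
  linear_combination (-1 : ℂ[X]) * h1 + a * h5

/-! ### Wronskians of coprime quadratic polynomials -/

lemma natDegree_eq_zero_of_wronskian_eq_zero {a b : ℂ[X]} (hab : IsCoprime a b)
    (hb : b ≠ 0) (hw : a * derivative b - derivative a * b = 0) :
    a.natDegree = 0 ∧ b.natDegree = 0 := by
  have h1 : derivative b = 0 := by
    have : b ∣ derivative b := hab.symm.dvd_of_dvd_mul_left
      ⟨derivative a, by linear_combination hw⟩
    by_contra h0
    exact absurd (Polynomial.degree_le_of_dvd this h0)
      (not_le.2 (Polynomial.degree_derivative_lt hb))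
  have h2 : derivative a = 0 := by
    rw [h1] at hw
    simpa [hb] using hw
  exact ⟨Polynomial.derivative_eq_zero.1 h2, Polynomial.derivative_eq_zero.1 h1⟩

/-- Cramer's rule: in three-space, a vector `y` in the plane spanned by two independent vectors `a`
and `b` is a combination of them. The minors of `a` and `b` are the coordinates of the normal of that
plane. -/
lemma exists_combination_of_det_eq_zero {a₀ a₁ a₂ b₀ b₁ b₂ y₀ y₁ y₂ : ℂ}
    (hdet : y₀ * (a₁ * b₂ - a₂ * b₁) - y₁ * (a₀ * b₂ - a₂ * b₀) + y₂ * (a₀ * b₁ - a₁ * b₀) = 0)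
    (hne : ¬(a₁ * b₂ - a₂ * b₁ = 0 ∧ a₀ * b₂ - a₂ * b₀ = 0 ∧ a₀ * b₁ - a₁ * b₀ = 0)) :
    ∃ A B : ℂ, y₀ = A * a₀ + B * b₀ ∧ y₁ = A * a₁ + B * b₁ ∧ y₂ = A * a₂ + B * b₂ := by
  by_cases h12 : a₁ * b₂ - a₂ * b₁ = 0
  · by_cases h02 : a₀ * b₂ - a₂ * b₀ = 0
    · have h01 : a₀ * b₁ - a₁ * b₀ ≠ 0 := fun h => hne ⟨h12, h02, h⟩
      refine ⟨(y₀ * b₁ - y₁ * b₀) / (a₀ * b₁ - a₁ * b₀), (a₀ * y₁ - a₁ * y₀) / (a₀ * b₁ - a₁ * b₀),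
        ?_, ?_, ?_⟩ <;> rw [div_mul_eq_mul_div, div_mul_eq_mul_div, ← add_div, eq_div_iff h01]
      · ring
      · ring
      · linear_combination hdet
    · refine ⟨(y₀ * b₂ - y₂ * b₀) / (a₀ * b₂ - a₂ * b₀), (a₀ * y₂ - a₂ * y₀) / (a₀ * b₂ - a₂ * b₀),
        ?_, ?_, ?_⟩ <;> rw [div_mul_eq_mul_div, div_mul_eq_mul_div, ← add_div, eq_div_iff h02]
      · ring
      · linear_combination (-1 : ℂ) * hdet
      · ring
  · refine ⟨(y₁ * b₂ - y₂ * b₁) / (a₁ * b₂ - a₂ * b₁), (a₁ * y₂ - a₂ * y₁) / (a₁ * b₂ - a₂ * b₁),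
        ?_, ?_, ?_⟩ <;> rw [div_mul_eq_mul_div, div_mul_eq_mul_div, ← add_div, eq_div_iff h12]
    · linear_combination hdet
    · ring
    · ring

lemma wronskian_quadratic (a₀ a₁ a₂ b₀ b₁ b₂ : ℂ) :
    (C a₂ * X ^ 2 + C a₁ * X + C a₀) * derivative (C b₂ * X ^ 2 + C b₁ * X + C b₀)
      - derivative (C a₂ * X ^ 2 + C a₁ * X + C a₀) * (C b₂ * X ^ 2 + C b₁ * X + C b₀)
    = C (a₁ * b₂ - a₂ * b₁) * X ^ 2 + C (2 * (a₀ * b₂ - a₂ * b₀)) * X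
      + C (a₀ * b₁ - a₁ * b₀) := by
  simp
  have h2 : (C 2 : ℂ[X]) = 2 := rfl
  rw [h2]; ring

lemma natDegree_quadratic_le_two (a b c : ℂ) :
    (C a * X ^ 2 + C b * X + C c).natDegree ≤ 2 := by compute_degree

lemma quadratic_injective {a b c a' b' c' : ℂ}
    (h : C a * X ^ 2 + C b * X + C c = C a' * X ^ 2 + C b' * X + C c') :
    a = a' ∧ b = b' ∧ c = c' := by
  refine ⟨?_, ?_, ?_⟩
  · simpa [coeff_X, coeff_C, coeff_X_pow] using congrArg (fun p => coeff p 2) h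
  · simpa [coeff_X, coeff_C, coeff_X_pow] using congrArg (fun p => coeff p 1) h
  · simpa [coeff_X, coeff_C, coeff_X_pow] using congrArg (fun p => coeff p 0) h

lemma eq_quadratic {p : ℂ[X]} (hp : p.natDegree ≤ 2) :
    ∃ a b c, p = C a * X ^ 2 + C b * X + C c :=
  ⟨_, _, _, eq_quadratic_of_degree_le_two (natDegree_le_iff_degree_le.1 hp)⟩

/-- If `w = c (X - r) ^ 2`, then comparing coefficients expresses the minors of `a` and `b` through
`c` and `r`, and expanding a determinant with a repeated row gives `c * a(r) = 0 = c * b(r)`. -/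
lemma squarefree_wronskian {a b : ℂ[X]} (ha : a.natDegree ≤ 2) (hb : b.natDegree ≤ 2)
    (hab : IsCoprime a b) (hw : a * derivative b - derivative a * b ≠ 0) :
    Squarefree (a * derivative b - derivative a * b) := by
  obtain ⟨a₂, a₁, a₀, rfl⟩ := eq_quadratic ha
  obtain ⟨b₂, b₁, b₀, rfl⟩ := eq_quadratic hb
  rw [wronskian_quadratic] at hw ⊢
  by_contra hsq
  rw [squarefree_iff_irreducible_sq_not_dvd_of_ne_zero hw] at hsq
  push Not at hsq
  obtain ⟨x, hx, y, hy⟩ := hsq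
  obtain ⟨r, hr⟩ := IsAlgClosed.exists_root x hx.degree_pos.ne'
  obtain ⟨q, rfl⟩ := dvd_iff_isRoot.2 hr
  have hq0 : (q ^ 2 * y) ≠ 0 := by
    rintro h
    apply hw
    rw [hy]
    linear_combination ((X - C r) * (X - C r)) * h
  have hdeg : (q ^ 2 * y).natDegree = 0 := by
    have h1 := natDegree_quadratic_le_two (a₁ * b₂ - a₂ * b₁) (2 * (a₀ * b₂ - a₂ * b₀))
      (a₀ * b₁ - a₁ * b₀)
    have h2 : (X - C r) * q * ((X - C r) * q) * y = (X - C r) ^ 2 * (q ^ 2 * y) := by ring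
    rw [hy, h2, natDegree_mul (pow_ne_zero _ (X_sub_C_ne_zero r)) hq0, natDegree_pow,
      natDegree_X_sub_C] at h1
    omega
  obtain ⟨c, hc⟩ := natDegree_eq_zero.1 hdeg
  have hc0 : c ≠ 0 := by
    rintro rfl
    exact hq0 (by rw [← hc, C_0])
  have hy' : C (a₁ * b₂ - a₂ * b₁) * X ^ 2 + C (2 * (a₀ * b₂ - a₂ * b₀)) * X
      + C (a₀ * b₁ - a₁ * b₀) = C c * X ^ 2 + C (- (2 * c * r)) * X + C (c * r ^ 2) := by
    rw [hy]
    have h2 : (C 2 : ℂ[X]) = 2 := rfl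
    simp only [C_mul, C_neg, C_pow, hc, h2]
    ring
  obtain ⟨h1, h2, h3⟩ := quadratic_injective hy'
  obtain ⟨s, t, hst⟩ := hab
  have hst' := congrArg (eval r) hst
  have ea : eval r (C a₂ * X ^ 2 + C a₁ * X + C a₀) = 0 := by
    apply mul_left_cancel₀ hc0
    simp only [eval_add, eval_mul, eval_pow, eval_C, eval_X]
    -- Expansion of the vanishing determinant with rows `a, a, b` along its first row.
    linear_combination (-a₀) * h1 + (a₁ / 2) * h2 - a₂ * h3
  have eb : eval r (C b₂ * X ^ 2 + C b₁ * X + C b₀) = 0 := by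
    apply mul_left_cancel₀ hc0
    simp only [eval_add, eval_mul, eval_pow, eval_C, eval_X]
    linear_combination (-b₀) * h1 + (b₁ / 2) * h2 - b₂ * h3
  rw [eval_add, eval_mul, eval_mul, ea, eb] at hst'
  simp at hst'

/-- If the Wronskian times its conjugate is a square, the span of `a` and `b` is invariant under
conjugation. -/
lemma exists_conj_eq_combination {a b r : ℂ[X]} (ha : a.natDegree ≤ 2) (hb : b.natDegree ≤ 2)
    (hab : IsCoprime a b) (hb0 : b ≠ 0)
    (hr : (a * derivative b - derivative a * b) *
      conjPoly (a * derivative b - derivative a * b) = r ^ 2) :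
    (∃ A B, conjPoly a = C A * a + C B * b) ∧ (∃ A B, conjPoly b = C A * a + C B * b) := by
  by_cases hw : a * derivative b - derivative a * b = 0
  · obtain ⟨h1, h2⟩ := natDegree_eq_zero_of_wronskian_eq_zero hab hb0 hw
    obtain ⟨p, rfl⟩ := natDegree_eq_zero.1 h1
    obtain ⟨q, rfl⟩ := natDegree_eq_zero.1 h2
    have hq : q ≠ 0 := by simpa using hb0
    refine ⟨⟨0, starRingEnd ℂ p / q, ?_⟩, ⟨0, starRingEnd ℂ q / q, ?_⟩⟩ <;>
      simp [conjPoly, ← C_mul, hq]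
  have hsq := squarefree_wronskian ha hb hab hw
  obtain ⟨c, hc⟩ : ∃ c, conjPoly (a * derivative b - derivative a * b)
      = C c * (a * derivative b - derivative a * b) := by
    obtain ⟨s, hs⟩ : (a * derivative b - derivative a * b) ∣ r :=
      (hsq.dvd_pow_iff_dvd two_ne_zero).1 ⟨_, hr.symm⟩
    have h1 : conjPoly (a * derivative b - derivative a * b)
        = s ^ 2 * (a * derivative b - derivative a * b) := by
      apply mul_left_cancel₀ hw
      rw [hr, hs]; ring
    have hs0 : s ^ 2 ≠ 0 := by
      intro h0
      apply hw
      rw [← conjPoly_conjPoly (a * derivative b - derivative a * b), h1, h0, zero_mul, map_zero]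
    have h2 := congrArg natDegree h1
    rw [natDegree_conjPoly, natDegree_mul hs0 hw] at h2
    obtain ⟨c, hc⟩ := natDegree_eq_zero.1 (show (s ^ 2).natDegree = 0 by omega)
    exact ⟨c, by rw [h1, hc]⟩
  -- By Cramer's rule it remains to see that the conjugate coefficient vectors are annihilated by the
  -- minors of `a` and `b`; they are annihilated by the conjugate minors, which are `c` times these.
  clear hsq hr
  obtain ⟨a₂, a₁, a₀, rfl⟩ := eq_quadratic ha
  obtain ⟨b₂, b₁, b₀, rfl⟩ := eq_quadratic hb
  rw [wronskian_quadratic] at hw hc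
  have hc' : C (starRingEnd ℂ (a₁ * b₂ - a₂ * b₁)) * X ^ 2
      + C (starRingEnd ℂ (2 * (a₀ * b₂ - a₂ * b₀))) * X + C (starRingEnd ℂ (a₀ * b₁ - a₁ * b₀))
      = C (c * (a₁ * b₂ - a₂ * b₁)) * X ^ 2 + C (c * (2 * (a₀ * b₂ - a₂ * b₀))) * X
      + C (c * (a₀ * b₁ - a₁ * b₀)) := by
    simp only [conjPoly, coe_mapRingHom, Polynomial.map_add, Polynomial.map_mul, Polynomial.map_pow, map_X, map_C] at hc
    rw [hc]
    simp only [C_mul]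
    ring
  obtain ⟨h1, h2, h3⟩ := quadratic_injective hc'
  simp only [map_sub, map_mul, map_ofNat] at h1 h2 h3
  have hne : ¬(a₁ * b₂ - a₂ * b₁ = 0 ∧ a₀ * b₂ - a₂ * b₀ = 0 ∧ a₀ * b₁ - a₁ * b₀ = 0) := by
    rintro ⟨h1, h2, h3⟩
    apply hw
    simp [h1, h2, h3]
  have hc0 : c ≠ 0 := by
    rintro rfl
    apply hw
    rw [← conjPoly_conjPoly (C (a₁ * b₂ - a₂ * b₁) * X ^ 2 + C (2 * (a₀ * b₂ - a₂ * b₀)) * X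
      + C (a₀ * b₁ - a₁ * b₀)), hc]
    simp
  have key : ∀ y₀ y₁ y₂ A B : ℂ, y₀ = A * a₀ + B * b₀ ∧ y₁ = A * a₁ + B * b₁ ∧
      y₂ = A * a₂ + B * b₂ → C y₂ * X ^ 2 + C y₁ * X + C y₀ =
      C A * (C a₂ * X ^ 2 + C a₁ * X + C a₀) + C B * (C b₂ * X ^ 2 + C b₁ * X + C b₀) := by
    rintro y₀ y₁ y₂ A B ⟨rfl, rfl, rfl⟩
    simp only [C_add, C_mul]; ring
  simp only [conjPoly, coe_mapRingHom, Polynomial.map_add, Polynomial.map_mul,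
    Polynomial.map_pow, map_X, map_C]
  constructor
  · obtain ⟨A, B, h⟩ := exists_combination_of_det_eq_zero (y₀ := starRingEnd ℂ a₀)
      (y₁ := starRingEnd ℂ a₁) (y₂ := starRingEnd ℂ a₂) (by
        apply mul_left_cancel₀ hc0
        linear_combination (-starRingEnd ℂ a₀) * h1 + starRingEnd ℂ a₁ / 2 * h2
          - starRingEnd ℂ a₂ * h3) hne
    exact ⟨A, B, key _ _ _ _ _ h⟩
  · obtain ⟨A, B, h⟩ := exists_combination_of_det_eq_zero (y₀ := starRingEnd ℂ b₀)
      (y₁ := starRingEnd ℂ b₁) (y₂ := starRingEnd ℂ b₂) (by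
        apply mul_left_cancel₀ hc0
        linear_combination (-starRingEnd ℂ b₀) * h1 + starRingEnd ℂ b₁ / 2 * h2
          - starRingEnd ℂ b₂ * h3) hne
    exact ⟨A, B, key _ _ _ _ _ h⟩


/-! ### The linear relation forced by the 2-PH condition -/

/-- The embedding of real polynomials into complex polynomials. -/
noncomputable abbrev complexPoly : ℝ[X] →+* ℂ[X] := Polynomial.mapRingHom Complex.ofRealHom

lemma conjPoly_complexPoly (p : ℝ[X]) : conjPoly (complexPoly p) = complexPoly p := by
  ext n
  simp [conjPoly, complexPoly]

lemma conjPoly_C (c : ℂ) : conjPoly (C c) = C (starRingEnd ℂ c) := by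
  simp [conjPoly]

lemma derivative_complexPoly (p : ℝ[X]) :
    derivative (complexPoly p) = complexPoly (derivative p) := by
  simp [complexPoly, Polynomial.derivative_map]

lemma natDegree_complexPoly (p : ℝ[X]) : (complexPoly p).natDegree = p.natDegree := by
  simp [complexPoly]

lemma complexPoly_injective : Function.Injective complexPoly :=
  Polynomial.map_injective _ Complex.ofRealHom.injective

/-- Linear dependence of real polynomials descends from `ℂ` to `ℝ`: take real or imaginary parts of
the coefficients. -/
lemma exists_real_relation {x y z s : ℝ[X]} {c₁ c₂ c₃ c₄ : ℂ}
    (hne : ¬(c₁ = 0 ∧ c₂ = 0 ∧ c₃ = 0 ∧ c₄ = 0))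
    (h : C c₁ * complexPoly x + C c₂ * complexPoly y + C c₃ * complexPoly z
      + C c₄ * complexPoly s = 0) :
    ∃ a b c d : ℝ, ¬(a = 0 ∧ b = 0 ∧ c = 0 ∧ d = 0) ∧ C a * x + C b * y + C c * z + C d * s = 0 := by
  have hre : C c₁.re * x + C c₂.re * y + C c₃.re * z + C c₄.re * s = 0 := by
    ext n
    simpa using congrArg (fun p => (coeff p n).re) h
  have him : C c₁.im * x + C c₂.im * y + C c₃.im * z + C c₄.im * s = 0 := by
    ext n
    simpa using congrArg (fun p => (coeff p n).im) h
  by_cases h0 : c₁.re = 0 ∧ c₂.re = 0 ∧ c₃.re = 0 ∧ c₄.re = 0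
  · refine ⟨_, _, _, _, fun h1 => hne ?_, him⟩
    simp only [Complex.ext_iff, Complex.zero_re, Complex.zero_im]
    tauto
  · exact ⟨_, _, _, _, h0, hre⟩

/-- With `a', b'` the conjugates of `a, b`, the left-hand side is `‖v'‖² - (‖v‖')²` for the curve `v`
whose Hopf form is `k, a, b`. -/
lemma derivative_mul_sub_derivative_mul (k a b a' b' : ℂ[X]) :
    derivative (k * (a * b')) * derivative (k * (a' * b))
      - derivative (k * (a * a')) * derivative (k * (b * b'))
    = k ^ 2 * ((a * derivative b - derivative a * b) * (a' * derivative b' - derivative a' * b')) := by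
  simp only [derivative_mul]
  ring

lemma natDegree_le_two_of_mul_conj {k a : ℂ[X]} (hk : k ≠ 0)
    (h : (k * (a * conjPoly a)).natDegree ≤ 4) : a.natDegree ≤ 2 := by
  by_cases ha : a = 0
  · simp [ha]
  have hca : conjPoly a ≠ 0 := fun h0 => ha (by rw [← conjPoly_conjPoly a, h0, map_zero])
  rw [natDegree_mul hk (mul_ne_zero ha hca), natDegree_mul ha hca, natDegree_conjPoly] at h
  omega

/-- Half of the derivative of `‖v‖ ^ 2 = s ^ 2`. -/
lemma sum_mul_derivative_eq {x y z s : ℝ[X]} (hs : x ^ 2 + y ^ 2 + z ^ 2 = s ^ 2) :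
    x * derivative x + y * derivative y + z * derivative z = s * derivative s := by
  have h := congrArg derivative hs
  simp only [derivative_add, derivative_pow, Nat.cast_ofNat, map_ofNat, pow_one,
    Nat.add_one_sub_one] at h
  apply mul_left_cancel₀ (two_ne_zero (α := ℝ[X]))
  linear_combination h

/-- Lagrange's identity for `v` and `v'`, where `‖v‖ = s` and `⟪v, v'⟫ = s s'`. -/
lemma wedge_sq_eq {x y z s : ℝ[X]} (hs : x ^ 2 + y ^ 2 + z ^ 2 = s ^ 2) :
    (y * derivative z - z * derivative y) ^ 2 + (z * derivative x - x * derivative z) ^ 2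
      + (x * derivative y - y * derivative x) ^ 2 =
    s ^ 2 * (derivative x ^ 2 + derivative y ^ 2 + derivative z ^ 2 - derivative s ^ 2) := by
  have h1 := sum_mul_derivative_eq hs
  linear_combination (derivative x ^ 2 + derivative y ^ 2 + derivative z ^ 2) * hs
    - (x * derivative x + y * derivative y + z * derivative z + s * derivative s) * h1

/-- The algebraic form of the converse: if `‖v‖` and `‖v ∧ v'‖` are polynomials and `v` has degree
at most four, then the coordinates of `v` and its norm are linearly dependent. -/
theorem exists_relation_of_wedge_sq {x y z s ρ : ℝ[X]} (hx : x.natDegree ≤ 4)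
    (hy : y.natDegree ≤ 4) (hz : z.natDegree ≤ 4) (hs : x ^ 2 + y ^ 2 + z ^ 2 = s ^ 2)
    (hρ : (y * derivative z - z * derivative y) ^ 2 + (z * derivative x - x * derivative z) ^ 2
      + (x * derivative y - y * derivative x) ^ 2 = ρ ^ 2) :
    ∃ a b c d : ℝ, ¬(a = 0 ∧ b = 0 ∧ c = 0 ∧ d = 0) ∧ C a * x + C b * y + C c * z + C d * s = 0 := by
  by_cases hsz : s = z
  · exact ⟨0, 0, 1, -1, by simp, by simp [hsz]⟩
  by_cases hs0 : s = 0
  · exact ⟨0, 0, 0, 1, by simp, by simp [hs0]⟩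
  have hsdeg : s.natDegree ≤ 4 := by
    have h1 : (x ^ 2 + y ^ 2 + z ^ 2).natDegree ≤ 8 := by
      have h2 : ∀ p : ℝ[X], p.natDegree ≤ 4 → (p ^ 2).natDegree ≤ 8 := fun p hp =>
        natDegree_pow_le.trans (by omega)
      exact natDegree_add_le_of_degree_le
        (natDegree_add_le_of_degree_le (h2 x hx) (h2 y hy)) (h2 z hz)
    rw [hs, natDegree_pow] at h1
    omega
  rw [wedge_sq_eq hs] at hρ
  have hI : (C Complex.I : ℂ[X]) ^ 2 = -1 := by rw [← C_pow, Complex.I_sq, C_neg, C_1]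
  have hZc : conjPoly (complexPoly x + C Complex.I * complexPoly y)
      = complexPoly x - C Complex.I * complexPoly y := by
    rw [map_add, map_mul, conjPoly_complexPoly, conjPoly_complexPoly, conjPoly_C, Complex.conj_I,
      C_neg]
    ring
  have hsC := congrArg complexPoly hs
  simp only [map_add, map_pow] at hsC
  have hN0 : complexPoly s - complexPoly z ≠ 0 := fun h =>
    hsz (complexPoly_injective (sub_eq_zero.1 h))
  obtain ⟨k, a, b, hab, hb0, hk, hZ, hP, hN⟩ := exists_hopf_factorization
    (Z := complexPoly x + C Complex.I * complexPoly y) (P := complexPoly s + complexPoly z)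
    (N := complexPoly s - complexPoly z)
    (by rw [hZc]; linear_combination hsC - complexPoly y ^ 2 * hI)
    (by rw [map_sub, conjPoly_complexPoly, conjPoly_complexPoly]) hN0
  have hk0 : k ≠ 0 := by rintro rfl; exact hN0 (by rw [hN, zero_mul])
  have hZ' : complexPoly x - C Complex.I * complexPoly y = k * (conjPoly a * b) := by
    rw [← hZc, hZ, map_mul, map_mul, conjPoly_conjPoly, hk]
  have hda : a.natDegree ≤ 2 := by
    apply natDegree_le_two_of_mul_conj hk0
    rw [← hP, ← map_add, natDegree_complexPoly]
    exact natDegree_add_le_of_degree_le hsdeg hz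
  have hdb : b.natDegree ≤ 2 := by
    apply natDegree_le_two_of_mul_conj hk0
    rw [← hN, ← map_sub, natDegree_complexPoly]
    exact (natDegree_sub_le _ _).trans (max_le hsdeg hz)
  have hρC : (complexPoly ρ) ^ 2 = (complexPoly s * k) ^ 2 *
      ((a * derivative b - derivative a * b) *
        conjPoly (a * derivative b - derivative a * b)) := by
    have h1 := congrArg complexPoly hρ
    have h2 := derivative_mul_sub_derivative_mul k a b (conjPoly a) (conjPoly b)
    rw [← hZ, ← hZ', ← hP, ← hN] at h2
    simp only [derivative_add, derivative_sub, derivative_mul, derivative_C,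
      derivative_complexPoly, derivative_conjPoly] at h2
    simp only [map_mul, map_pow, map_sub, map_add] at h1 ⊢
    linear_combination (-1 : ℂ[X]) * h1 + complexPoly s ^ 2 * h2
      + complexPoly s ^ 2 * complexPoly (derivative y) ^ 2 * hI
  have hsk : complexPoly s * k ≠ 0 :=
    mul_ne_zero (fun h => hs0 (complexPoly_injective (by rw [h, map_zero]))) hk0
  obtain ⟨r, hr⟩ : complexPoly s * k ∣ complexPoly ρ :=
    (UniqueFactorizationMonoid.pow_dvd_pow_iff_dvd two_ne_zero).1 ⟨_, hρC⟩
  have hw : (a * derivative b - derivative a * b) *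
      conjPoly (a * derivative b - derivative a * b) = r ^ 2 := by
    apply mul_left_cancel₀ (pow_ne_zero 2 hsk)
    rw [← hρC, hr]; ring
  obtain ⟨⟨A, B, hA⟩, ⟨A', B', hB⟩⟩ := exists_conj_eq_combination hda hdb hab hb0 hw
  -- The coefficients of the relation `A' (s + z) + B' (x - iy) - A (x + iy) - B (s - z) = 0`.
  refine exists_real_relation (c₁ := B' - A) (c₂ := - (Complex.I * (A + B'))) (c₃ := A' + B)
    (c₄ := A' - B) ?_ ?_
  · rintro ⟨h1, h2, h3, h4⟩
    have h5 : A + B' = 0 := by simpa using h2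
    have hA' : A' = 0 := by linear_combination (h3 + h4) / 2
    have hB' : B' = 0 := by linear_combination (h1 + h5) / 2
    apply hb0
    rw [← conjPoly_conjPoly b, hB, hA', hB']
    simp
  · simp only [C_sub, C_add, C_neg, C_mul]
    linear_combination C A' * hP - C A * hZ + C B' * hZ' - C B * hN - k * conjPoly a * hB
      + k * conjPoly b * hA


/-! ### Polynomial curves in space -/

lemma eq_of_eval_eq_on {I : Set ℝ} (hI : I.Infinite) {p q : ℝ[X]}
    (h : ∀ t ∈ I, p.eval t = q.eval t) : p = q :=
  Polynomial.eq_of_infinite_eval_eq p q (hI.mono h)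

lemma deriv_eq_of_coordinates {α : ℝ → Space3} {P : Fin 3 → ℝ[X]}
    (h : ∀ t i, α t i = (P i).eval t) (t : ℝ) (i : Fin 3) :
    deriv α t i = (derivative (P i)).eval t := by
  have hdiff : DifferentiableAt ℝ α t := differentiableAt_euclidean.2 fun j => by
    simpa only [h] using (P j).differentiableAt
  have h1 : HasDerivAt (fun s => α s i) (deriv α t i) t :=
    (EuclideanSpace.proj i : Space3 →L[ℝ] ℝ).hasFDerivAt.comp_hasDerivAt t hdiff.hasDerivAt
  simp only [h] at h1
  exact h1.unique ((P i).hasDerivAt t)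

lemma norm_wedge_sq (v w : Space3) :
    ‖wedge v w‖ ^ 2 = (v 1 * w 2 - v 2 * w 1) ^ 2 + (v 2 * w 0 - v 0 * w 2) ^ 2
      + (v 0 * w 1 - v 1 * w 0) ^ 2 := by
  simp [EuclideanSpace.real_norm_sq_eq, Fin.sum_univ_three, wedge, cross_apply]

lemma norm_sq_eq_sum (v : Space3) : ‖v‖ ^ 2 = v 0 ^ 2 + v 1 ^ 2 + v 2 ^ 2 := by
  simp [EuclideanSpace.real_norm_sq_eq, Fin.sum_univ_three]

lemma inner_eq_sum (v w : Space3) : inner ℝ v w = v 0 * w 0 + v 1 * w 1 + v 2 * w 2 := by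
  simp [PiLp.inner_apply, Fin.sum_univ_three]
  ring

lemma isPlanarOn_of_relation {α : ℝ → Space3} {P : Fin 3 → ℝ[X]}
    (h : ∀ t i, α t i = (P i).eval t) (I : Set ℝ) {a b c : ℝ} (hne : ¬(a = 0 ∧ b = 0 ∧ c = 0))
    (hrel : C a * derivative (P 0) + C b * derivative (P 1) + C c * derivative (P 2) = 0) :
    IsPlanarOn α I := by
  have h1 : derivative (C a * P 0 + C b * P 1 + C c * P 2) = 0 := by
    simpa using hrel
  obtain ⟨d, hd⟩ := natDegree_eq_zero.1 (derivative_eq_zero.1 h1)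
  refine ⟨!₂[a, b, c], fun h0 => hne ⟨?_, ?_, ?_⟩, d, fun t _ => ?_⟩
  · simpa using congrArg (fun v : Space3 => v 0) h0
  · simpa using congrArg (fun v : Space3 => v 1) h0
  · simpa using congrArg (fun v : Space3 => v 2) h0
  · rw [inner_eq_sum, h, h, h]
    simpa using (congrArg (eval t) hd).symm

/-- The Gram determinant of `u = (a, b, c)`, `v` and `v'`, where `‖v‖ = s` and `⟪u, v⟫ = m s`. -/
lemma det_sq_eq_mul_wedge_sq {x y z s : ℝ[X]} {a b c m : ℝ}
    (hs : x ^ 2 + y ^ 2 + z ^ 2 = s ^ 2) (hm : C a * x + C b * y + C c * z = C m * s) :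
    (C a * (y * derivative z - z * derivative y) + C b * (z * derivative x - x * derivative z)
      + C c * (x * derivative y - y * derivative x)) ^ 2 =
    C (a ^ 2 + b ^ 2 + c ^ 2 - m ^ 2) * ((y * derivative z - z * derivative y) ^ 2
      + (z * derivative x - x * derivative z) ^ 2 + (x * derivative y - y * derivative x) ^ 2) := by
  have hm' : C a * derivative x + C b * derivative y + C c * derivative z = C m * derivative s := by
    simpa using congrArg derivative hm
  have h1 := sum_mul_derivative_eq hs
  simp only [C_sub, C_add, C_pow]
  generalize derivative x = x', derivative y = y', derivative z = z', derivative s = s',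
    C a = a, C b = b, C c = c, C m = m at *
  have gram : (a * (y * z' - z * y') + b * (z * x' - x * z') + c * (x * y' - y * x')) ^ 2
      = (a ^ 2 + b ^ 2 + c ^ 2) * ((y * z' - z * y') ^ 2 + (z * x' - x * z') ^ 2
          + (x * y' - y * x') ^ 2)
        - (a * x + b * y + c * z) ^ 2 * (x' ^ 2 + y' ^ 2 + z' ^ 2)
        + 2 * (a * x + b * y + c * z) * (x * x' + y * y' + z * z') * (a * x' + b * y' + c * z')
        - (a * x' + b * y' + c * z') ^ 2 * (x ^ 2 + y ^ 2 + z ^ 2) := by ring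
  have lagrange : (y * z' - z * y') ^ 2 + (z * x' - x * z') ^ 2 + (x * y' - y * x') ^ 2
      = (x ^ 2 + y ^ 2 + z ^ 2) * (x' ^ 2 + y' ^ 2 + z' ^ 2)
        - (x * x' + y * y' + z * z') ^ 2 := by ring
  rw [gram, lagrange, hm, hm', h1, hs]
  ring

/-! ### Helices and 2-PH curves -/

theorem is2PHOn_of_isHelixOn {I : Set ℝ} (hI : I.Infinite) {α : ℝ → Space3} {P : Fin 3 → ℝ[X]}
    (h : ∀ t i, α t i = (P i).eval t) (hplane : ¬ IsPlanarOn α I) (hhel : IsHelixOn α I) :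
    Is2PHOn α I := by
  obtain ⟨u, hu, θ, hθ⟩ := hhel
  have hd := deriv_eq_of_coordinates h
  have hdd := deriv_eq_of_coordinates hd
  set m := Real.cos θ * ‖u‖ with hm
  have hu0 : ¬(u 0 = 0 ∧ u 1 = 0 ∧ u 2 = 0) := by
    rintro ⟨h0, h1, h2⟩
    apply hu
    ext i
    fin_cases i <;> simpa
  have hum : ∀ t ∈ I, inner ℝ u (deriv α t) = m * ‖deriv α t‖ := by
    intro t ht
    by_cases h0 : deriv α t = 0
    · simp [h0]
    · rw [← InnerProductGeometry.cos_angle_mul_norm_mul_norm, hθ t ht h0, hm]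
      ring
  have hm0 : m ≠ 0 := by
    intro h0
    refine hplane (isPlanarOn_of_relation h I hu0 (eq_of_eval_eq_on hI fun t ht => ?_))
    have h1 := hum t ht
    rw [h0, zero_mul, inner_eq_sum, hd, hd, hd] at h1
    simpa using h1
  obtain ⟨σ, hσ⟩ : ∃ σ : ℝ[X], ∀ t ∈ I, ‖deriv α t‖ = σ.eval t := by
    refine ⟨C m⁻¹ * (C (u 0) * derivative (P 0) + C (u 1) * derivative (P 1)
      + C (u 2) * derivative (P 2)), fun t ht => ?_⟩
    have h1 := hum t ht
    rw [inner_eq_sum, hd, hd, hd] at h1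
    simp only [eval_mul, eval_add, eval_C]
    rw [h1, inv_mul_cancel_left₀ hm0]
  refine ⟨⟨σ, hσ⟩, ?_⟩
  have hs : derivative (P 0) ^ 2 + derivative (P 1) ^ 2 + derivative (P 2) ^ 2 = σ ^ 2 := by
    refine eq_of_eval_eq_on hI fun t ht => ?_
    simp only [eval_pow, eval_add]
    rw [← hσ t ht, norm_sq_eq_sum, hd, hd, hd]
  have hrel : C (u 0) * derivative (P 0) + C (u 1) * derivative (P 1) + C (u 2) * derivative (P 2)
      = C m * σ := by
    refine eq_of_eval_eq_on hI fun t ht => ?_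
    have h1 := hum t ht
    rw [inner_eq_sum, hd, hd, hd, hσ t ht] at h1
    simpa using h1
  -- Equality in the Cauchy-Schwarz inequality would make the tangent parallel to `u`.
  have hpos : 0 < u 0 ^ 2 + u 1 ^ 2 + u 2 ^ 2 - m ^ 2 := by
    have hle : m ^ 2 ≤ u 0 ^ 2 + u 1 ^ 2 + u 2 ^ 2 := by
      rw [← norm_sq_eq_sum, hm, mul_pow]
      exact mul_le_of_le_one_left (sq_nonneg _) (Real.cos_sq_le_one θ)
    refine lt_of_le_of_ne (sub_nonneg.2 hle) fun h0 => ?_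
    have hpar : ∀ t ∈ I, u 1 * (derivative (P 2)).eval t - u 2 * (derivative (P 1)).eval t = 0 ∧
        u 2 * (derivative (P 0)).eval t - u 0 * (derivative (P 2)).eval t = 0 ∧
        u 0 * (derivative (P 1)).eval t - u 1 * (derivative (P 0)).eval t = 0 := by
      intro t _
      have h1 := congrArg (eval t) hs
      have h2 := congrArg (eval t) hrel
      simp only [eval_add, eval_mul, eval_pow, eval_C] at h1 h2
      generalize (derivative (P 0)).eval t = x, (derivative (P 1)).eval t = y,
        (derivative (P 2)).eval t = z, σ.eval t = s at *
      have h3 : (u 1 * z - u 2 * y) ^ 2 + (u 2 * x - u 0 * z) ^ 2 + (u 0 * y - u 1 * x) ^ 2 = 0 := by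
        linear_combination (u 0 ^ 2 + u 1 ^ 2 + u 2 ^ 2) * h1
          - (u 0 * x + u 1 * y + u 2 * z + m * s) * h2 - s ^ 2 * h0
      refine ⟨?_, ?_, ?_⟩ <;> apply pow_eq_zero_iff two_ne_zero |>.1 <;>
        nlinarith [sq_nonneg (u 1 * z - u 2 * y), sq_nonneg (u 2 * x - u 0 * z),
          sq_nonneg (u 0 * y - u 1 * x)]
    -- A nonzero row of the cross product matrix of `u` is normal to a plane containing the curve.
    by_cases h12 : u 1 = 0 ∧ u 2 = 0
    · refine hplane (isPlanarOn_of_relation h I (a := -u 1) (b := u 0) (c := 0)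
        (fun h3 => hu0 ⟨h3.2.1, h12⟩) (eq_of_eval_eq_on hI fun t ht => ?_))
      simp only [eval_add, eval_mul, eval_C, eval_zero]
      linear_combination (hpar t ht).2.2
    · refine hplane (isPlanarOn_of_relation h I (a := 0) (b := -u 2) (c := u 1)
        (fun h3 => h12 ⟨h3.2.2, neg_eq_zero.1 h3.2.1⟩) (eq_of_eval_eq_on hI fun t ht => ?_))
      simp only [eval_add, eval_mul, eval_C, eval_zero]
      linear_combination (hpar t ht).1
  have hdet := det_sq_eq_mul_wedge_sq hs hrel
  set δ := u 0 ^ 2 + u 1 ^ 2 + u 2 ^ 2 - m ^ 2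
  set D := C (u 0) * (derivative (P 1) * derivative (derivative (P 2))
      - derivative (P 2) * derivative (derivative (P 1)))
    + C (u 1) * (derivative (P 2) * derivative (derivative (P 0))
      - derivative (P 0) * derivative (derivative (P 2)))
    + C (u 2) * (derivative (P 0) * derivative (derivative (P 1))
      - derivative (P 1) * derivative (derivative (P 0)))
  refine ⟨C (Real.sqrt δ)⁻¹ * D, fun t _ => ?_⟩
  rw [← abs_norm, ← sq_eq_sq_iff_abs_eq_abs, norm_wedge_sq]
  simp only [hd, hdd]
  have h1 := congrArg (eval t) hdet
  simp only [eval_add, eval_sub, eval_mul, eval_pow, eval_C] at h1 ⊢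
  rw [mul_pow, inv_pow, Real.sq_sqrt hpos.le, h1, inv_mul_cancel_left₀ hpos.ne']

theorem isHelixOn_of_is2PHOn {I : Set ℝ} (hI : I.Infinite) {α : ℝ → Space3} {P : Fin 3 → ℝ[X]}
    (h : ∀ t i, α t i = (P i).eval t) (hdeg : ∀ i, (P i).natDegree ≤ 5)
    (hplane : ¬ IsPlanarOn α I) (h2PH : Is2PHOn α I) : IsHelixOn α I := by
  obtain ⟨⟨σ, hσ⟩, ρ, hρ⟩ := h2PH
  have hd := deriv_eq_of_coordinates h
  have hdd := deriv_eq_of_coordinates hd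
  have hdeg' : ∀ i, (derivative (P i)).natDegree ≤ 4 := fun i =>
    (natDegree_derivative_le _).trans (Nat.sub_le_of_le_add (hdeg i))
  have hs : derivative (P 0) ^ 2 + derivative (P 1) ^ 2 + derivative (P 2) ^ 2 = σ ^ 2 := by
    refine eq_of_eval_eq_on hI fun t ht => ?_
    simp only [eval_pow, eval_add]
    rw [← hσ t ht, norm_sq_eq_sum, hd, hd, hd]
  obtain ⟨a, b, c, d, hne, hrel⟩ := exists_relation_of_wedge_sq (ρ := ρ) (hdeg' 0) (hdeg' 1)
    (hdeg' 2) hs (by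
      refine eq_of_eval_eq_on hI fun t ht => ?_
      rw [eval_pow, ← sq_abs (eval t ρ), ← hρ t ht, norm_wedge_sq]
      simp [hd, hdd])
  have habc : ¬(a = 0 ∧ b = 0 ∧ c = 0) := by
    rintro ⟨rfl, rfl, rfl⟩
    have hd0 : d ≠ 0 := fun h0 => hne ⟨rfl, rfl, rfl, h0⟩
    have hσ0 : σ = 0 := by simpa [hd0] using hrel
    -- Here the curve is constant, so every vector is normal to a plane containing it.
    refine hplane (isPlanarOn_of_relation h I (a := 1) (b := 0) (c := 0) (by simp)
      (eq_of_eval_eq_on hI fun t ht => ?_))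
    have h0 : deriv α t = 0 := by
      rw [← norm_eq_zero, hσ t ht, hσ0, eval_zero]
    simp [← hd, h0]
  refine ⟨!₂[a, b, c], fun h0 => habc ⟨?_, ?_, ?_⟩,
    Real.arccos (-d / ‖(!₂[a, b, c] : Space3)‖), fun t ht hv => ?_⟩
  · simpa using congrArg (fun v : Space3 => v 0) h0
  · simpa using congrArg (fun v : Space3 => v 1) h0
  · simpa using congrArg (fun v : Space3 => v 2) h0
  · have h1 := congrArg (eval t) hrel
    simp only [eval_add, eval_mul, eval_C, eval_zero, ← hd, ← hσ t ht] at h1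
    have h2 : inner ℝ (!₂[a, b, c] : Space3) (deriv α t) = -d * ‖deriv α t‖ := by
      rw [inner_eq_sum]
      simp
      linear_combination h1
    rw [InnerProductGeometry.angle, h2, mul_div_mul_right _ _ (norm_ne_zero_iff.2 hv)]

theorem mainTheorem1 (I : Set ℝ) (hI : I.OrdConnected) (hI' : I.Nontrivial)
    (α : ℝ → Space3) (hα : IsPolynomialCurve α 5) (hplane : ¬ IsPlanarOn α I) :
    IsHelixOn α I ↔ Is2PHOn α I := by
  obtain ⟨P, hP, hdeg⟩ := hα
  have hinf : I.Infinite := by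
    obtain ⟨s, hs, t, ht, hst⟩ := hI'.exists_lt
    exact (Set.Icc_infinite hst).mono (hI.out hs ht)
  exact ⟨is2PHOn_of_isHelixOn hinf hP hplane, isHelixOn_of_is2PHOn hinf hP
    (fun i => hdeg ▸ Finset.le_sup (f := fun i => (P i).natDegree) (Finset.mem_univ i)) hplane⟩
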